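/- Let $k$ be a field with algebraic closure $\bar k$, and let $C$ be a curve over $k$, where a curve over $k$ means a smooth, proper, geometrically irreducible $k$-scheme of dimension $1$. Let $(D,\pi_1,\pi_2)$ be a self-correspondence on $C$, that is: $D$ is a smooth and proper $k$-scheme each of whose connected components is a curve over $k$, and $\pi_1,\pi_2\colon D\to C$ are $k$-morphisms whose restrictions to every connected component of $D$ are non-constant and separable (the induced extension of function fields is separable). Let $\Gamma_D$ be the directed graph (loops and repeated edges allowed) with vertex set $C(\bar k)$, edge set $D(\bar k)$, source map $\pi_1$ and target map $\pi_2$. A set $S\subseteq C(\bar k)$ is complete if, for every edge $z\in D(\bar k)$, $\pi_1(z)\in S$ if and only if $\pi_2(z)\in S$; a complete set is irreducible if it is non-empty and contains no complete proper non-empty subset. An edge $z\in D(\bar k)$ is étale if the ramification indices at $z$ of $\pi_1$ and $\pi_2$ (base changed to $\bar k$) are both equal to $1$, and a set $S\subseteq C(\bar k)$ is étale if every edge $z$ with $\pi_1(z)\in S$ and $\pi_2(z)\in S$ is étale. Then $\Gamma_D$ has infinitely many irreducible complete sets, and all but finitely many irreducible complete sets of $\Gamma_D$ are étale. -/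

import Mathlib

open CategoryTheory CategoryTheory.Limits AlgebraicGeometry

universe u

/-- A directed graph: a set `V` of vertices, a set `Z` of edges, and source and target maps.
Self-loops and repeated edges are allowed. -/
structure DirectedGraph where
  /-- the vertices -/
  V : Type u
  /-- the edges -/
  Z : Type u
  /-- the source of an edge -/
  s : Z → V
  /-- the target of an edge -/
  t : Z → V

namespace DirectedGraph

variable (Γ : DirectedGraph.{u})

/-- `y` is a forward-neighbor of `x` if there is an edge with source `x` and target `y`. -/
def IsForwardNeighbor (x y : Γ.V) : Prop := ∃ z : Γ.Z, Γ.s z = x ∧ Γ.t z = y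

/-- `y` is a backward-neighbor of `x` if there is an edge with source `y` and target `x`. -/
def IsBackwardNeighbor (x y : Γ.V) : Prop := ∃ z : Γ.Z, Γ.s z = y ∧ Γ.t z = x

/-- `S` contains every forward-neighbor of its vertices. -/
def IsForwardComplete (S : Set Γ.V) : Prop := ∀ x ∈ S, ∀ y, Γ.IsForwardNeighbor x y → y ∈ S

/-- `S` contains every backward-neighbor of its vertices. -/
def IsBackwardComplete (S : Set Γ.V) : Prop := ∀ x ∈ S, ∀ y, Γ.IsBackwardNeighbor x y → y ∈ S

/-- `S` is both forward-complete and backward-complete. -/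
def IsComplete (S : Set Γ.V) : Prop := Γ.IsForwardComplete S ∧ Γ.IsBackwardComplete S

/-- A complete set is irreducible if it is non-empty and has no complete proper non-empty
subset. -/
def IsIrreducibleComplete (S : Set Γ.V) : Prop :=
  Γ.IsComplete S ∧ S.Nonempty ∧ ∀ T : Set Γ.V, T ⊂ S → T.Nonempty → ¬ Γ.IsComplete T

end DirectedGraph

/-- A curve over the field `k`: a proper smooth scheme over `Spec k`, of dimension one, and
geometrically irreducible (in particular non-empty). -/
structure IsCurve {k : Type u} [Field k] {C : Scheme.{u}} (p : C ⟶ Spec (.of k)) : Prop where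
  proper : IsProper p
  smooth : SmoothOfRelativeDimension 1 p
  irreducible : GeometricallyIrreducible p

/-- A morphism of schemes is non-constant if its image is not contained in a single point. -/
def IsNonconstant {X Y : Scheme.{u}} (f : X ⟶ Y) : Prop := ¬ ∃ y : Y, ∀ x : X, f x = y

/-- A morphism `f : X ⟶ Y` out of an irreducible scheme is separable if the homomorphism of
stalks that it induces at the generic point `η` of `X` is a separable extension. For a non-constant morphism
of curves `f η` is the generic point of `Y`, and this is the extension of function fields. -/
def IsSeparableMorphism {X Y : Scheme.{u}} (f : X ⟶ Y) : Prop :=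
  ∀ η : X, IsGenericPoint η Set.univ →
    letI := (f.stalkMap η).hom.toAlgebra
    Algebra.IsSeparable (Y.presheaf.stalk (f η)) (X.presheaf.stalk η)

/-- A self-correspondence on `C` over `k`: a smooth and proper scheme `D` over `k` each of whose
connected components is a curve, with two `k`-morphisms from `D` to `C` that are non-constant and
separable on every connected component of `D`. -/
structure SelfCorrespondence {k : Type u} [Field k] {C : Scheme.{u}}
    (p : C ⟶ Spec (.of k)) where
  /-- the scheme `D` -/
  D : Scheme.{u}
  /-- the structure morphism of `D` -/
  str : D ⟶ Spec (.of k)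
  /-- the first projection -/
  π₁ : D ⟶ C
  /-- the second projection -/
  π₂ : D ⟶ C
  comp_π₁ : π₁ ≫ p = str
  comp_π₂ : π₂ ≫ p = str
  proper : IsProper str
  smooth : Smooth str
  component : ∀ x : D, ∃ U : D.Opens, (U : Set D) = connectedComponent x ∧
    IsCurve (U.ι ≫ str) ∧
    IsNonconstant (U.ι ≫ π₁) ∧ IsSeparableMorphism (U.ι ≫ π₁) ∧
    IsNonconstant (U.ι ≫ π₂) ∧ IsSeparableMorphism (U.ι ≫ π₂)

noncomputable section

section GeometricPoints

variable {k : Type u} [Field k] (K : Type u) [Field K] [Algebra k K]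

/-- The morphism `Spec K ⟶ Spec k` attached to a field extension `K` of `k`. -/
abbrev baseMap : Spec (.of K) ⟶ Spec (.of k) :=
  Spec.map (CommRingCat.ofHom (algebraMap k K))

/-- The set `X(K)` of `K`-points of the `k`-scheme `X`. -/
abbrev KPoint {X : Scheme.{u}} (p : X ⟶ Spec (.of k)) : Type u :=
  {x : Spec (.of K) ⟶ X // x ≫ p = baseMap K}

/-- The map `X(K) → Y(K)` induced by a `k`-morphism `f : X ⟶ Y`. -/
def KPoint.map {X Y : Scheme.{u}} {p : X ⟶ Spec (.of k)} {q : Y ⟶ Spec (.of k)}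
    (f : X ⟶ Y) (hf : f ≫ q = p) (x : KPoint K p) : KPoint K q :=
  ⟨x.1 ≫ f, by rw [Category.assoc, hf, x.2]⟩

/-- The base change `X_K` of the `k`-scheme `X`. -/
abbrev baseChange {X : Scheme.{u}} (p : X ⟶ Spec (.of k)) : Scheme.{u} :=
  pullback p (baseMap (k := k) K)

/-- The base change `f_K : X_K ⟶ Y_K` of a `k`-morphism `f : X ⟶ Y`. -/
def baseChangeMap {X Y : Scheme.{u}} {p : X ⟶ Spec (.of k)} {q : Y ⟶ Spec (.of k)}
    (f : X ⟶ Y) (hf : f ≫ q = p) : baseChange K p ⟶ baseChange K q :=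
  pullback.map p (baseMap K) q (baseMap K) f (𝟙 _) (𝟙 _) (by simp [hf]) (by simp)

/-- The closed point of `X_K` defined by a `K`-point of `X`. -/
def KPoint.toBaseChange {X : Scheme.{u}} {p : X ⟶ Spec (.of k)} (x : KPoint K p) :
    baseChange K p :=
  pullback.lift x.1 (𝟙 (Spec (.of K))) (by simp [x.2]) (IsLocalRing.closedPoint K)

/-- The ramification index of a morphism of schemes `f : X ⟶ Y` at a point `z` of `X`: that of
the homomorphism of local rings from the stalk of `Y` at `f z` to the stalk of `X` at `z`. -/
def ramificationIndexAt {X Y : Scheme.{u}} (f : X ⟶ Y) (z : X) : ℕ :=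
  letI := (f.stalkMap z).hom.toAlgebra
  (IsLocalRing.maximalIdeal (X.presheaf.stalk z)).ramificationIdx (Y.presheaf.stalk (f z))

end GeometricPoints

namespace SelfCorrespondence

variable {k : Type u} [Field k] {C : Scheme.{u}} {p : C ⟶ Spec (.of k)}
  (𝒟 : SelfCorrespondence p) (kbar : Type u) [Field kbar] [Algebra k kbar]

/-- The directed graph attached to a self-correspondence: vertices `C(kbar)`, edges `D(kbar)`,
source map `π₁` and target map `π₂`. -/
def graph : DirectedGraph.{u} where
  V := KPoint kbar p
  Z := KPoint kbar 𝒟.str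
  s := KPoint.map kbar 𝒟.π₁ 𝒟.comp_π₁
  t := KPoint.map kbar 𝒟.π₂ 𝒟.comp_π₂

/-- The ramification index `e_{1,z}` of `π₁` (over `kbar`) at the edge `z`. -/
def e₁ (z : (𝒟.graph kbar).Z) : ℕ :=
  ramificationIndexAt (baseChangeMap kbar 𝒟.π₁ 𝒟.comp_π₁) (KPoint.toBaseChange kbar z)

/-- The ramification index `e_{2,z}` of `π₂` (over `kbar`) at the edge `z`. -/
def e₂ (z : (𝒟.graph kbar).Z) : ℕ :=
  ramificationIndexAt (baseChangeMap kbar 𝒟.π₂ 𝒟.comp_π₂) (KPoint.toBaseChange kbar z)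

/-- An edge is étale if both ramification indices are one. -/
def IsEtaleEdge (z : (𝒟.graph kbar).Z) : Prop := 𝒟.e₁ kbar z = 1 ∧ 𝒟.e₂ kbar z = 1

/-- A set of vertices is étale if all the edges with both source and target in it are étale. -/
def IsEtaleSet (S : Set (𝒟.graph kbar).V) : Prop :=
  ∀ z : (𝒟.graph kbar).Z, (𝒟.graph kbar).s z ∈ S → (𝒟.graph kbar).t z ∈ S →
    𝒟.IsEtaleEdge kbar z

end SelfCorrespondence

end

/-!
Let `t` be an étale coordinate on a non-empty affine open subset of `C`. Function fields of curves
have transcendence degree one, so along all but finitely many edges the values `a` and `b` of `t` at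
the source and the target satisfy `F(a, b) = 0` for one of finitely many non-zero polynomials `F`.

If there were only finitely many irreducible complete sets, choose a point in each of them, and let
`k₀ ⊆ K` be generated over the prime field by the values of `t` at these points, the values at the
endpoints of the exceptional edges, the finitely many values that `t` omits, and the coefficients of
the polynomials `F`. The elements of `K` that lie in a finite extension of `k₀` whose degree only
has small prime factors form a set `T` closed under all the relations `F(a, b) = 0`. The preimage of
`T` under `t` is then complete and meets every irreducible complete set, so it contains every point
and `T = K`. But since `k₀` is finitely generated, `K` contains elements of degree over `k₀`
divisible by any given large prime `ℓ`: a generator of the field with `p ^ ℓ` elements over `𝔽_p`,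
an `ℓ`-th root of `2` over `ℚ`, an `ℓ`-th root of a transcendental `x` over `L(x)`, while a finite
extension of the base field only loses finitely many `ℓ`.

A non-constant separable morphism is unramified at the generic point, hence on a dense open subset,
so only finitely many edges are not étale, and each of them lies in at most one irreducible complete
set.
-/

/-! ### Degrees divisible by large primes -/

section LargePrimeDegrees

open Polynomial IntermediateField Filter

theorem finrank_restrictScalars_adjoin_simple {F L K : Type*} [Field F] [Field L] [Field K]
    [Algebra F L] [Algebra F K] [Algebra L K] [IsScalarTower F L K] {c : K} (hc : IsIntegral L c) :
    Module.finrank F (L⟮c⟯.restrictScalars F) =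
      Module.finrank F L * (minpoly L c).natDegree := by
  rw [← adjoin.finrank hc]
  exact (Module.finrank_mul_finrank F L L⟮c⟯).symm

theorem exists_dvd_natDegree_minpoly {F K : Type*} [Field F] [Field K] [Algebra F K]
    [IsAlgClosed K] {ℓ : ℕ} (hℓ : ℓ.Prime) {a : F} (ha : ∀ b : F, b ^ ℓ ≠ a) :
    ∃ c : K, IsIntegral F c ∧ ℓ ∣ (minpoly F c).natDegree := by
  have hirr := X_pow_sub_C_irreducible_of_prime hℓ ha
  have hmonic : (X ^ ℓ - C a).Monic := monic_X_pow_sub_C a hℓ.ne_zero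
  obtain ⟨c, hc⟩ := IsAlgClosed.exists_aeval_eq_zero K _ hirr.degree_pos.ne'
  refine ⟨c, ⟨_, hmonic, hc⟩, ?_⟩
  rw [← minpoly.eq_of_irreducible_of_monic hirr hc hmonic, natDegree_X_pow_sub_C]

theorem pow_ne_adjoinSimple_gen {F K : Type*} [Field F] [Field K] [Algebra F K] {t : K}
    (ht : Transcendental F t) {n : ℕ} (hn : n ≠ 1) (b : F⟮t⟯) : b ^ n ≠ AdjoinSimple.gen F t := by
  intro hb
  obtain ⟨r, s, hrs⟩ := (mem_adjoin_simple_iff F (b : K)).1 b.2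
  have hpow : (aeval t r / aeval t s) ^ n = t := by
    rw [← hrs]
    exact congrArg (algebraMap F⟮t⟯ K) hb
  have hs0 : aeval t s ≠ 0 := fun h => ht <| by
    rw [← hpow, h, div_zero]
    exact isAlgebraic_zero.pow n
  have hs : s ≠ 0 := ne_zero_of_map hs0
  rw [div_pow, div_eq_iff (pow_ne_zero _ hs0)] at hpow
  have hpoly : r ^ n = X * s ^ n := transcendental_iff_injective.1 ht (by simpa using hpow)
  have hdeg := congrArg natDegree hpoly
  rw [natDegree_pow, natDegree_X_mul (pow_ne_zero _ hs), natDegree_pow] at hdeg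
  exact hn (Nat.dvd_one.1 ((Nat.dvd_add_right (Dvd.intro _ rfl)).1 (hdeg ▸ Dvd.intro _ rfl)))

theorem rat_pow_ne_two {n : ℕ} (hn : n ≠ 1) (b : ℚ) : b ^ n ≠ 2 := by
  intro hb
  have hval := congrArg (padicValRat 2) hb
  rw [padicValRat.pow, show (2 : ℚ) = ((2 : ℕ) : ℚ) by norm_num,
    padicValRat.self (by norm_num)] at hval
  exact hn (by exact_mod_cast Int.eq_one_of_dvd_one (by positivity) ⟨_, hval.symm⟩)

/-- For every large enough prime number `ℓ`, the field `K` contains an element that is algebraic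
over `F` of degree divisible by `ℓ`. -/
def HasLargePrimeDegrees (F K : Type*) [Field F] [Field K] [Algebra F K] : Prop :=
  ∀ᶠ ℓ : ℕ in atTop, ℓ.Prime → ∃ c : K, IsIntegral F c ∧ ℓ ∣ (minpoly F c).natDegree

namespace HasLargePrimeDegrees

theorem of_finiteDimensional {F L K : Type*} [Field F] [Field L] [Field K] [Algebra F L]
    [Algebra F K] [Algebra L K] [IsScalarTower F L K] [FiniteDimensional F L]
    (h : HasLargePrimeDegrees F K) : HasLargePrimeDegrees L K := by
  filter_upwards [h, eventually_gt_atTop (Module.finrank F L)] with ℓ hℓ hlt hprime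
  obtain ⟨c, hc, hdvd⟩ := hℓ hprime
  have hcL : IsIntegral L c := hc.tower_top
  refine ⟨c, hcL, (hprime.dvd_mul.1 ?_).resolve_left
    (Nat.not_dvd_of_pos_of_lt Module.finrank_pos hlt)⟩
  have hle : F⟮c⟯ ≤ L⟮c⟯.restrictScalars F :=
    IntermediateField.adjoin_simple_le_iff.2 (mem_adjoin_simple_self L c)
  have hFc := finrank_dvd_of_le_right hle
  rw [adjoin.finrank hc, finrank_restrictScalars_adjoin_simple hcL] at hFc
  exact hdvd.trans hFc

theorem adjoin_simple {F K : Type*} [Field F] [Field K] [Algebra F K] [IsAlgClosed K]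
    (h : HasLargePrimeDegrees F K) (t : K) : HasLargePrimeDegrees F⟮t⟯ K := by
  by_cases ht : IsAlgebraic F t
  · have := adjoin.finiteDimensional ht.isIntegral
    exact h.of_finiteDimensional
  · exact .of_forall fun ℓ hℓ =>
      exists_dvd_natDegree_minpoly hℓ (pow_ne_adjoinSimple_gen ht hℓ.ne_one)

theorem adjoin_finset {F K : Type*} [Field F] [Field K] [Algebra F K] [IsAlgClosed K]
    (h : HasLargePrimeDegrees F K) (S : Finset K) :
    HasLargePrimeDegrees (IntermediateField.adjoin F (S : Set K)) K :=
  induction_on_adjoin_finset S (fun L => HasLargePrimeDegrees L K) h.of_finiteDimensional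
    fun _ x _ hL => hL.adjoin_simple x

theorem rat (K : Type*) [Field K] [CharZero K] [IsAlgClosed K] : HasLargePrimeDegrees ℚ K :=
  .of_forall fun _ hℓ => exists_dvd_natDegree_minpoly hℓ (rat_pow_ne_two hℓ.ne_one)

theorem zmod (p : ℕ) [Fact p.Prime] (K : Type*) [Field K] [Algebra (ZMod p) K] [IsAlgClosed K] :
    HasLargePrimeDegrees (ZMod p) K := by
  refine .of_forall fun ℓ hℓ => ?_
  let e : GaloisField p ℓ →ₐ[ZMod p] K := IsAlgClosed.lift
  obtain ⟨α, hα⟩ := Field.exists_primitive_element (ZMod p) (GaloisField p ℓ)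
  have hint : IsIntegral (ZMod p) α := Algebra.IsIntegral.isIntegral α
  refine ⟨e α, hint.map e, ?_⟩
  rw [minpoly.algHom_eq e e.injective, ← adjoin.finrank hint, hα, finrank_top',
    GaloisField.finrank p hℓ.ne_zero]

theorem exists_subfield {K : Type*} [Field K] [IsAlgClosed K] {S : Set K} (hS : S.Finite) :
    ∃ k₀ : Subfield K, S ⊆ k₀ ∧ HasLargePrimeDegrees k₀ K := by
  lift S to Finset K using hS
  obtain ⟨p, hp⟩ := CharP.exists K
  obtain hprime | rfl := CharP.char_is_prime_or_zero K p
  · have : Fact p.Prime := ⟨hprime⟩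
    let : Algebra (ZMod p) K := ZMod.algebra K p
    exact ⟨(IntermediateField.adjoin (ZMod p) (S : Set K)).toSubfield, subset_adjoin _ _,
      (zmod p K).adjoin_finset S⟩
  · have : CharZero K := CharP.charP_to_charZero K
    exact ⟨(IntermediateField.adjoin ℚ (S : Set K)).toSubfield, subset_adjoin _ _,
      (rat K).adjoin_finset S⟩

end HasLargePrimeDegrees

/-- The elements of `K` contained in a finite extension of `F` whose degree only has prime factors
less than `N`. As `0` is not a smooth number, such an extension is automatically finite. -/
def smoothDegreeElements (F K : Type*) [Field F] [Field K] [Algebra F K] (N : ℕ) : Set K :=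
  {a | ∃ L : IntermediateField F K, Module.finrank F L ∈ N.smoothNumbers ∧ a ∈ L}

section

variable {F K : Type*} [Field F] [Field K] [Algebra F K] {N : ℕ}

theorem algebraMap_mem_smoothDegreeElements (a : F) :
    algebraMap F K a ∈ smoothDegreeElements F K N :=
  ⟨⊥, by simp [Nat.mem_smoothNumbers],
    IntermediateField.algebraMap_mem ⊥ a⟩

theorem mem_smoothDegreeElements_of_aeval_eq_zero {L : IntermediateField F K}
    (hL : Module.finrank F L ∈ N.smoothNumbers) {q : L[X]} (hq : q ≠ 0) (hdeg : q.natDegree < N)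
    {b : K} (hb : aeval b q = 0) : b ∈ smoothDegreeElements F K N := by
  have hint : IsIntegral L b := isAlgebraic_iff_isIntegral.1 ⟨q, hq, hb⟩
  refine ⟨L⟮b⟯.restrictScalars F, ?_, mem_adjoin_simple_self L b⟩
  rw [finrank_restrictScalars_adjoin_simple hint]
  exact Nat.mul_mem_smoothNumbers hL <| Nat.mem_smoothNumbers_of_lt (minpoly.natDegree_pos hint)
    ((natDegree_le_of_dvd (minpoly.dvd L b hb) hq).trans_lt hdeg)

theorem HasLargePrimeDegrees.smoothDegreeElements_ne_univ (h : HasLargePrimeDegrees F K) (N : ℕ) :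
    smoothDegreeElements F K N ≠ Set.univ := by
  obtain ⟨M, hM⟩ := eventually_atTop.1 h
  obtain ⟨ℓ, hle, hprime⟩ := Nat.exists_infinite_primes (max M N)
  obtain ⟨c, hc, hdvd⟩ := hM ℓ (le_of_max_le_left hle) hprime
  refine (Set.ne_univ_iff_exists_notMem _).2 ⟨c, fun ⟨L, hL, hcL⟩ => ?_⟩
  have hfinrank := finrank_dvd_of_le_right (adjoin_simple_le_iff.2 hcL)
  rw [adjoin.finrank hc] at hfinrank
  exact (Nat.mem_smoothNumbers'.1 hL _ hprime (hdvd.trans hfinrank)).not_ge (le_of_max_le_right hle)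

end

end LargePrimeDegrees

section PolyRelated

open Polynomial

/-- `b` is a root of the non-zero polynomial `F(a, Y)` for some `F(X, Y)` in the set `E`. The roots
of the zero polynomial are the empty multiset, so that `F(a, Y) ≠ 0` is part of the condition. -/
def PolyRelated {k K : Type*} [CommRing k] [CommRing K] [IsDomain K] [Algebra k K] (E : Set k[X][X])
    (a b : K) : Prop :=
  ∃ F ∈ E, b ∈ (F.map (aeval a : k[X] →ₐ[k] K).toRingHom).roots

theorem PolyRelated.mono {k K : Type*} [CommRing k] [CommRing K] [IsDomain K] [Algebra k K]
    {E E' : Set k[X][X]} (h : E ⊆ E') {a b : K} (hab : PolyRelated E a b) : PolyRelated E' a b :=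
  hab.imp fun _ => And.imp_left fun hF => h hF

theorem PolyRelated.mem_smoothDegreeElements {k K : Type*} [CommRing k] [Field K] [Algebra k K]
    {k₀ : Subfield K} {E : Set k[X][X]} {N : ℕ}
    (hcoeff : ∀ F ∈ E, ∀ i j, algebraMap k K ((F.coeff i).coeff j) ∈ k₀)
    (hdeg : ∀ F ∈ E, F.natDegree < N) {a b : K} (ha : a ∈ smoothDegreeElements k₀ K N)
    (hab : PolyRelated E a b) : b ∈ smoothDegreeElements k₀ K N := by
  obtain ⟨L, hL, haL⟩ := ha
  obtain ⟨F, hF, hroot⟩ := hab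
  rw [mem_roots', IsRoot.def] at hroot
  have hlifts : F.map (aeval a : k[X] →ₐ[k] K).toRingHom ∈ lifts (algebraMap L K) := by
    refine (lifts_iff_coeff_lifts _).2 fun i => ⟨⟨aeval a (F.coeff i), ?_⟩, by rw [coeff_map]; rfl⟩
    simp only [aeval_eq_sum_range, Algebra.smul_def]
    exact sum_mem fun j _ =>
      mul_mem (L.algebraMap_mem ⟨_, hcoeff F hF i j⟩) (pow_mem haL j)
  obtain ⟨q, hq⟩ := (mem_lifts _).1 hlifts
  rw [← hq] at hroot
  refine mem_smoothDegreeElements_of_aeval_eq_zero hL (q := q)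
    ((Polynomial.map_ne_zero_iff (algebraMap L K).injective).1 hroot.1) ?_
    (by rw [← eval_map_algebraMap, hroot.2])
  rw [← natDegree_map (algebraMap L K), hq]
  exact natDegree_map_le.trans_lt (hdeg F hF)

theorem exists_ne_univ_forall_polyRelated_mem {k K : Type*} [CommRing k] [Field K] [IsAlgClosed K]
    [Algebra k K] {S : Set K} (hS : S.Finite) {E : Set k[X][X]} (hE : E.Finite) :
    ∃ T : Set K, S ⊆ T ∧ T ≠ Set.univ ∧ ∀ a ∈ T, ∀ b, PolyRelated E a b → b ∈ T := by
  let coeffs : Set K := ⋃ F ∈ E, ⋃ i ∈ F.support, algebraMap k K '' (F.coeff i).coeffs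
  have hcoeffs : coeffs.Finite := hE.biUnion fun F _ =>
    F.support.finite_toSet.biUnion fun i _ => (Finset.finite_toSet _).image _
  obtain ⟨k₀, hk₀, hlarge⟩ := HasLargePrimeDegrees.exists_subfield (hS.union hcoeffs)
  rw [Set.union_subset_iff] at hk₀
  obtain ⟨d, hd⟩ := (hE.image natDegree).bddAbove
  refine ⟨smoothDegreeElements k₀ K (d + 1),
    fun a ha => algebraMap_mem_smoothDegreeElements (⟨a, hk₀.1 ha⟩ : k₀),
    hlarge.smoothDegreeElements_ne_univ _,
    fun a ha b hab => hab.mem_smoothDegreeElements (fun F hF i j => ?_)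
      (fun F hF => Nat.lt_succ_of_le (hd ⟨F, hF, rfl⟩)) ha⟩
  by_cases hij : (F.coeff i).coeff j = 0
  · rw [hij, map_zero]
    exact zero_mem _
  · have hi : F.coeff i ≠ 0 := fun h => hij (by rw [h, coeff_zero])
    exact hk₀.2 (Set.mem_biUnion hF (Set.mem_biUnion (mem_support_iff.2 hi)
      ⟨_, coeff_mem_coeffs hij, rfl⟩))

end PolyRelated

namespace DirectedGraph

variable {Γ : DirectedGraph.{u}}

theorem isComplete_iff {S : Set Γ.V} :
    Γ.IsComplete S ↔ ∀ z : Γ.Z, Γ.s z ∈ S ↔ Γ.t z ∈ S := by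
  refine ⟨fun h z => ⟨fun hz => h.1 _ hz _ ⟨z, rfl, rfl⟩, fun hz => h.2 _ hz _ ⟨z, rfl, rfl⟩⟩,
    fun h => ⟨?_, ?_⟩⟩
  · rintro x hx y ⟨z, rfl, rfl⟩
    exact (h z).1 hx
  · rintro x hx y ⟨z, rfl, rfl⟩
    exact (h z).2 hx

theorem IsIrreducibleComplete.subset {S T : Set Γ.V} (hS : Γ.IsIrreducibleComplete S)
    (hT : Γ.IsComplete T) (hST : (S ∩ T).Nonempty) : S ⊆ T := by
  by_contra hnot
  refine hS.2.2 (S ∩ T) ⟨Set.inter_subset_left, fun h => hnot fun y hy => (h hy).2⟩ hST ?_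
  exact isComplete_iff.2 fun z => and_congr (isComplete_iff.1 hS.1 z) (isComplete_iff.1 hT z)

theorem IsIrreducibleComplete.eq {S T : Set Γ.V} (hS : Γ.IsIrreducibleComplete S)
    (hT : Γ.IsIrreducibleComplete T) (hST : (S ∩ T).Nonempty) : S = T :=
  (hS.subset hT.1 hST).antisymm (hT.subset hS.1 (Set.inter_comm S T ▸ hST))

theorem exists_isIrreducibleComplete_mem (x : Γ.V) :
    ∃ S : Set Γ.V, Γ.IsIrreducibleComplete S ∧ x ∈ S := by
  refine ⟨⋂₀ {T | Γ.IsComplete T ∧ x ∈ T}, ⟨?_, ⟨x, fun T hT => hT.2⟩, ?_⟩, fun T hT => hT.2⟩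
  · exact isComplete_iff.2 fun z => forall₂_congr fun T hT => isComplete_iff.1 hT.1 z
  · intro T hT ⟨y, hy⟩ hTc
    by_cases hx : x ∈ T
    · exact hT.2 fun w hw => hw T ⟨hTc, hx⟩
    · exact hT.1 hy Tᶜ ⟨isComplete_iff.2 fun z => not_congr (isComplete_iff.1 hTc z), hx⟩ hy

theorem finite_setOf_isIrreducibleComplete_inter {B : Set Γ.V} (hB : B.Finite) :
    {S : Set Γ.V | Γ.IsIrreducibleComplete S ∧ (S ∩ B).Nonempty}.Finite := by
  choose f hf hmem using exists_isIrreducibleComplete_mem (Γ := Γ)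
  refine (hB.image f).subset ?_
  rintro S ⟨hS, x, hxS, hxB⟩
  exact ⟨x, hxB, (hf x).eq hS ⟨x, hmem x, hxS⟩⟩

theorem exists_finite_forall_isComplete_eq_univ
    (hfin : {S : Set Γ.V | Γ.IsIrreducibleComplete S}.Finite) :
    ∃ B : Set Γ.V, B.Finite ∧ ∀ T, Γ.IsComplete T → B ⊆ T → T = Set.univ := by
  have hne : ∀ S : {S : Set Γ.V | Γ.IsIrreducibleComplete S}, ∃ x, x ∈ S.1 := fun S => S.2.2.1
  choose r hr using hne
  have := hfin.to_subtype
  refine ⟨Set.range r, Set.finite_range r, fun T hT hrT => Set.eq_univ_of_forall fun x => ?_⟩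
  obtain ⟨S, hS, hxS⟩ := exists_isIrreducibleComplete_mem x
  exact hS.subset hT ⟨r ⟨S, hS⟩, hr ⟨S, hS⟩, hrT ⟨_, rfl⟩⟩ hxS

open Polynomial in
theorem infinite_setOf_isIrreducibleComplete {k K : Type*} [CommRing k] [Field K] [IsAlgClosed K]
    [Algebra k K] {f : Γ.V → K} (hf : (Set.range f)ᶜ.Finite) {E : Set k[X][X]} (hE : E.Finite)
    (hst : {z | ¬ PolyRelated E (f (Γ.s z)) (f (Γ.t z))}.Finite)
    (hts : {z | ¬ PolyRelated E (f (Γ.t z)) (f (Γ.s z))}.Finite) :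
    {S : Set Γ.V | Γ.IsIrreducibleComplete S}.Infinite := by
  intro hirr
  obtain ⟨B, hB, hBuniv⟩ := exists_finite_forall_isComplete_eq_univ hirr
  obtain ⟨T, hT, hne, hclosed⟩ := exists_ne_univ_forall_polyRelated_mem
    (((hf.union (hB.image f)).union (hst.image (f ∘ Γ.t))).union (hts.image (f ∘ Γ.s))) hE
  simp only [Set.union_subset_iff, Set.image_subset_iff] at hT
  obtain ⟨⟨⟨hfT, hBT⟩, hstT⟩, htsT⟩ := hT
  have hcomplete : Γ.IsComplete (f ⁻¹' T) := isComplete_iff.2 fun z =>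
    ⟨fun hs => by_contra fun ht => ht (hstT fun h => ht (hclosed _ hs _ h)),
      fun ht => by_contra fun hs => hs (htsT fun h => hs (hclosed _ ht _ h))⟩
  have huniv := hBuniv _ hcomplete hBT
  refine hne (Set.eq_univ_of_forall fun a => ?_)
  by_cases ha : a ∈ Set.range f
  · obtain ⟨x, rfl⟩ := ha
    exact huniv.ge (Set.mem_univ x)
  · exact hfT ha

end DirectedGraph

/-! ### Étale algebras over `k[X]` -/

section QuasiFinite

open Polynomial TensorProduct

theorem isAlgebraic_of_quasiFinite_of_flat (R B : Type*) [CommRing R] [IsDomain R] [CommRing B]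
    [Algebra R B] [Algebra.QuasiFinite R B] [Module.Flat R B] : Algebra.IsAlgebraic R B := by
  let K := FractionRing R
  have : Module.Finite K (K ⊗[R] B) := .of_quasiFinite
  have : Algebra.IsAlgebraic R (K ⊗[R] B) :=
    (IsFractionRing.comap_isAlgebraic_iff (K := K)).2 inferInstance
  exact .of_injective (Algebra.TensorProduct.includeRight : B →ₐ[R] K ⊗[R] B)
    (Algebra.TensorProduct.includeRight_injective (IsFractionRing.injective R K))

theorem dimensionLEOne_of_quasiFinite_of_flat (R B : Type*) [CommRing R] [IsDomain R]
    [Ring.DimensionLEOne R] [CommRing B] [IsDomain B] [Algebra R B] [Algebra.QuasiFinite R B]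
    [Module.Flat R B] : Ring.DimensionLEOne B := by
  refine ⟨fun {P} hP hprime => ?_⟩
  have := isAlgebraic_of_quasiFinite_of_flat R B
  obtain ⟨b, hbP, hb⟩ := Submodule.exists_mem_ne_zero_of_ne_bot hP
  have hunder : P.under R ≠ ⊥ :=
    Ideal.comap_ne_bot_of_algebraic_mem hb hbP (Algebra.IsAlgebraic.isAlgebraic b)
  have hmax : (P.under R).IsMaximal := Ring.DimensionLEOne.maximalOfPrime hunder inferInstance
  obtain ⟨M, hM, hPM⟩ := P.exists_le_maximal hprime.ne_top
  have hunder_eq : P.under R = M.under R :=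
    hmax.eq_of_le (Ideal.IsPrime.ne_top inferInstance) (Ideal.comap_mono hPM)
  rwa [Algebra.QuasiFinite.eq_of_le_of_under_eq (R := R) P M hPM hunder_eq]

theorem nonempty_algHom_of_quasiFinite {R B K : Type*} [CommRing R] [CommRing B] [Algebra R B]
    [Algebra.QuasiFinite R B] [Field K] [IsAlgClosed K] [Algebra R K] (q : Ideal B) [q.IsPrime]
    (hq : q.under R = RingHom.ker (algebraMap R K)) : Nonempty (B →ₐ[R] K) := by
  let := Localization.AtPrime.algebraOfLiesOver (q.under R) q
  let φ : (q.under R).ResidueField →ₐ[R] K := Ideal.ResidueField.liftₐ _ (Algebra.ofId R K) hq.le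
    fun r hr => IsUnit.mk0 _ fun h => hr (hq.ge h)
  let := φ.toRingHom.toAlgebra
  have : IsScalarTower R (q.under R).ResidueField K := .of_algebraMap_eq' φ.comp_algebraMap.symm
  let ψ : q.ResidueField →ₐ[(q.under R).ResidueField] K := IsAlgClosed.lift
  exact ⟨(ψ.restrictScalars R).comp (IsScalarTower.toAlgHom R B q.ResidueField)⟩

theorem isReduced_of_etale (R B : Type*) [CommRing R] [IsDomain R] [CommRing B] [Algebra R B]
    [Algebra.Etale R B] : IsReduced B := by
  let K := FractionRing R
  have : IsReduced (K ⊗[R] B) := Algebra.FormallyUnramified.isReduced_of_field K (K ⊗[R] B)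
  exact isReduced_of_injective (Algebra.TensorProduct.includeRight : B →ₐ[R] K ⊗[R] B)
    (Algebra.TensorProduct.includeRight_injective (IsFractionRing.injective R K))

theorem isDomain_of_etale (R B : Type*) [CommRing R] [IsDomain R] [CommRing B] [Algebra R B]
    [Algebra.Etale R B] [IrreducibleSpace (PrimeSpectrum B)] : IsDomain B := by
  have := isReduced_of_etale R B
  have := (PrimeSpectrum.irreducibleSpace_iff_isPrime_nilradical (R := B)).1 inferInstance
  rw [nilradical_eq_zero] at this
  exact .of_bot_isPrime B

section Polynomial

variable (k B K : Type*) [Field k] [CommRing B] [Algebra k B] [Algebra k[X] B]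
  [IsScalarTower k k[X] B] [Module.Flat k[X] B]

theorem transcendental_algebraMap_X [Nontrivial B] : Transcendental k (algebraMap k[X] B X) := by
  have := Module.Flat.isTorsionFree (R := k[X]) (M := B)
  exact (transcendental_algebraMap_iff (FaithfulSMul.algebraMap_injective k[X] B)).2
    (transcendental_X k)

variable [Algebra.QuasiFinite k[X] B]

theorem trdeg_eq_one_of_quasiFinite_polynomial [IsDomain B] : Algebra.trdeg k B = 1 := by
  have := isAlgebraic_of_quasiFinite_of_flat k[X] B
  have := Module.Flat.isTorsionFree (R := k[X]) (M := B)
  have h := lift_trdeg_add_eq k k[X] B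
  rw [trdeg_eq_zero (R := k[X]) (A := B), Polynomial.trdeg_of_isDomain] at h
  simpa using h.symm

variable {B} in
theorem finite_quotient_of_ne_bot [IsDomain B] {I : Ideal B} (hI : I ≠ ⊥) :
    Module.Finite k (B ⧸ I) := by
  have := isAlgebraic_of_quasiFinite_of_flat k[X] B
  obtain ⟨b, hbI, hb⟩ := Submodule.exists_mem_ne_zero_of_ne_bot hI
  have hunder : I.under k[X] ≠ ⊥ :=
    Ideal.comap_ne_bot_of_algebraic_mem hb hbI (Algebra.IsAlgebraic.isAlgebraic b)
  obtain ⟨f, hfI, hf⟩ := Submodule.exists_mem_ne_zero_of_ne_bot hunder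
  have hle : Ideal.span {f} ≤ I.under k[X] := (Ideal.span_singleton_le_iff_mem _).2 hfI
  have : Module.Finite k (k[X] ⧸ Ideal.span {f}) := (AdjoinRoot.powerBasis hf).finite
  have : Module.Finite k (k[X] ⧸ I.under k[X]) :=
    .of_surjective (Ideal.Quotient.factorₐ k hle).toLinearMap (Ideal.Quotient.factor_surjective hle)
  have : Algebra.QuasiFinite (k[X] ⧸ I.under k[X]) (B ⧸ I) := .of_restrictScalars k[X] _ _
  have : Algebra.QuasiFinite k (B ⧸ I) := .trans k (k[X] ⧸ I.under k[X]) (B ⧸ I)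
  exact .of_quasiFinite

variable {k B} in
theorem finite_setOf_algHom_apply_eq_zero [IsDomain B] [CommRing K] [IsDomain K] [Algebra k K]
    {b : B} (hb : b ≠ 0) : {h : B →ₐ[k] K | h b = 0}.Finite := by
  have := finite_quotient_of_ne_bot k (Ideal.span_singleton_eq_bot.not.2 hb)
  refine (Set.finite_range fun g : (B ⧸ Ideal.span {b}) →ₐ[k] K =>
    g.comp (Ideal.Quotient.mkₐ k _)).subset fun h hh => ?_
  have hker : Ideal.span {b} ≤ RingHom.ker h := (Ideal.span_singleton_le_iff_mem _).2 hh
  exact ⟨Ideal.Quotient.liftₐ _ h hker, by ext; rfl⟩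

/- A flat, finitely presented homomorphism has open image on spectra, so that `Spec B ⟶ 𝔸¹` misses
only finitely many closed points. -/
theorem finite_setOf_forall_algHom_ne [Nontrivial B] [Algebra.FinitePresentation k[X] B] [Field K]
    [IsAlgClosed K] [Algebra k K] :
    {a : K | ∀ h : B →ₐ[k] K, h (algebraMap k[X] B X) ≠ a}.Finite := by
  have : Algebra.HasGoingDown k[X] B := .of_flat
  obtain ⟨P, hP⟩ := Set.range_nonempty (PrimeSpectrum.comap (algebraMap k[X] B))
  obtain ⟨_, ⟨_, ⟨f, rfl⟩, rfl⟩, hPf, hf⟩ :=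
    PrimeSpectrum.isBasis_basic_opens.exists_subset_of_mem_open hP
      PrimeSpectrum.isOpenMap_comap_of_hasGoingDown_of_finitePresentation.isOpen_range
  have hf0 : f ≠ 0 := by
    rintro rfl
    exact hPf (zero_mem _)
  refine (f.rootSet_finite K).subset fun a ha => by_contra fun hroot => ?_
  have hfa : aeval a f ≠ 0 := fun h => hroot (mem_rootSet.2 ⟨hf0, h⟩)
  let := (aeval (R := k) a).toRingHom.toAlgebra
  have : IsScalarTower k k[X] K := .of_algebraMap_eq' (aeval a).comp_algebraMap.symm
  obtain ⟨q, hq⟩ := hf (show (⟨RingHom.ker (algebraMap k[X] K), RingHom.ker_isPrime _⟩ :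
    PrimeSpectrum k[X]) ∈ _ from hfa)
  obtain ⟨h⟩ := nonempty_algHom_of_quasiFinite q.asIdeal (congrArg PrimeSpectrum.asIdeal hq)
  exact ha (h.restrictScalars k) ((h.commutes X).trans (aeval_X a))

end Polynomial

theorem isAlgebraic_polynomial_of_trdeg_eq_one {k B : Type*} [Field k] [CommRing B] [IsDomain B]
    [Algebra k B] [Algebra k[X] B] [IsScalarTower k k[X] B] [FaithfulSMul k[X] B]
    (hB : Algebra.trdeg k B = 1) : Algebra.IsAlgebraic k[X] B := by
  have h := lift_trdeg_add_eq k k[X] B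
  rw [hB, Polynomial.trdeg_of_isDomain, Cardinal.lift_one, Cardinal.lift_one] at h
  have h0 := Cardinal.eq_of_add_eq_add_left (h.trans (add_zero 1).symm) Cardinal.one_lt_aleph0
  exact trdeg_eq_zero_iff.1 (Cardinal.lift_eq_zero.1 h0)

theorem exists_ne_zero_eval_map_aeval_eq_zero {k B : Type*} [Field k] [CommRing B] [IsDomain B]
    [Algebra k B] (hB : Algebra.trdeg k B = 1) {t₁ : B} (ht₁ : Transcendental k t₁) (t₂ : B) :
    ∃ F : k[X][X], F ≠ 0 ∧ (F.map (aeval t₁ : k[X] →ₐ[k] B).toRingHom).eval t₂ = 0 := by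
  let := (aeval (R := k) t₁).toRingHom.toAlgebra
  have : IsScalarTower k k[X] B := .of_algebraMap_eq' (aeval t₁).comp_algebraMap.symm
  have : FaithfulSMul k[X] B := (faithfulSMul_iff_algebraMap_injective _ _).2
    (transcendental_iff_injective.1 ht₁)
  obtain ⟨F, hF0, hF⟩ := (isAlgebraic_polynomial_of_trdeg_eq_one hB).isAlgebraic t₂
  exact ⟨F, hF0, (Polynomial.eval_map _ _).trans hF⟩

theorem polyRelated_singleton_of_coeff_ne_zero {k B K : Type*} [CommRing k] [CommRing B]
    [Algebra k B] [CommRing K] [IsDomain K] [Algebra k K] {F : k[X][X]} {t₁ t₂ : B}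
    (hF : (F.map (aeval t₁ : k[X] →ₐ[k] B).toRingHom).eval t₂ = 0) (h : B →ₐ[k] K) {n : ℕ}
    (hn : h (aeval t₁ (F.coeff n)) ≠ 0) : PolyRelated {F} (h t₁) (h t₂) := by
  have hmap : F.map (aeval (h t₁) : k[X] →ₐ[k] K).toRingHom =
      (F.map (aeval t₁ : k[X] →ₐ[k] B).toRingHom).map h.toRingHom := by
    rw [aeval_algHom, Polynomial.map_map]
    rfl
  refine ⟨F, rfl, ?_⟩
  rw [hmap, mem_roots', IsRoot.def]
  refine ⟨fun h0 => hn ?_, ?_⟩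
  · have hcoeff := congrArg (coeff · n) h0
    simp only [coeff_map, coeff_zero] at hcoeff
    exact hcoeff
  · exact (eval_map_apply ..).trans ((congrArg h hF).trans (map_zero h))

theorem exists_forall_polyRelated {k B : Type*} [Field k] [CommRing B] [IsDomain B] [Algebra k B]
    (hB : Algebra.trdeg k B = 1) {t₁ : B} (ht₁ : Transcendental k t₁) (t₂ : B) (K : Type*)
    [CommRing K] [IsDomain K] [Algebra k K] :
    ∃ F : k[X][X], ∃ b : B, b ≠ 0 ∧ ∀ h : B →ₐ[k] K, h b ≠ 0 → PolyRelated {F} (h t₁) (h t₂) := by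
  obtain ⟨F, hF0, hF⟩ := exists_ne_zero_eval_map_aeval_eq_zero hB ht₁ t₂
  obtain ⟨n, hn⟩ : ∃ n, F.coeff n ≠ 0 := by
    by_contra! h
    exact hF0 (Polynomial.ext h)
  exact ⟨F, aeval t₁ (F.coeff n), fun h => hn (transcendental_iff.1 ht₁ _ h),
    fun h hb => polyRelated_singleton_of_coeff_ne_zero hF h hb⟩

end QuasiFinite

/-! ### Étale coordinates on smooth curves -/

section EtaleChart

open Polynomial

/-- An affine open subscheme `Spec B` of a `k`-scheme `X`, together with an étale `k`-algebra
homomorphism `k[X] → B`. -/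
structure EtaleChart {k : Type u} [Field k] {X : Scheme.{u}} (p : X ⟶ Spec (.of k)) where
  /-- the coordinate ring -/
  B : CommRingCat.{u}
  /-- the inclusion -/
  j : Spec B ⟶ X
  isOpenImmersion : IsOpenImmersion j
  /-- the étale homomorphism -/
  g : k[X] →+* B
  etale : g.Etale
  comp : j ≫ p = Spec.map (CommRingCat.ofHom (g.comp C))

/-- The point of `X` underlying a `K`-point. -/
noncomputable def KPoint.pt {k : Type u} [Field k] {X : Scheme.{u}} {p : X ⟶ Spec (.of k)}
    {K : Type u} [Field K] [Algebra k K] (x : KPoint K p) : X :=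
  x.1 (IsLocalRing.closedPoint K)

theorem KPoint.range_subset {k : Type u} [Field k] {X : Scheme.{u}} {p : X ⟶ Spec (.of k)}
    {K : Type u} [Field K] [Algebra k K] (x : KPoint K p) {S : Set X} (hx : x.pt ∈ S) :
    Set.range x.1 ⊆ S := by
  rintro _ ⟨y, rfl⟩
  rwa [Subsingleton.elim y (IsLocalRing.closedPoint K)]

namespace EtaleChart

section Existence

variable {k : Type u} [Field k] {X : Scheme.{u}} (p : X ⟶ Spec (.of k))

theorem exists_mem_range [hp : SmoothOfRelativeDimension 1 p] (x : X) :
    ∃ c : EtaleChart p, x ∈ Set.range c.j := by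
  obtain ⟨U, -, V, hV, hxV, e, h⟩ := hp.exists_isStandardSmoothOfRelativeDimension x
  obtain rfl : U = ⊤ := top_le_iff.1 fun y _ => by
    rw [Subsingleton.elim y (p x)]
    exact e hxV
  have hsm := RingHom.isStandardSmoothOfRelativeDimension_respectsIso.right
    (p.appLE ⊤ V e).hom (Scheme.ΓSpecIso (.of k)).symm.commRingCatIsoToRingEquiv h
  obtain ⟨g, hgC, hg⟩ := hsm.exists_etale_mvPolynomial
  let σ : k[X] ≃ₐ[k] MvPolynomial (Fin 1) k := (MvPolynomial.uniqueAlgEquiv k (Fin 1)).symm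
  have hσC : σ.toRingEquiv.toRingHom.comp C = MvPolynomial.C := RingHom.ext σ.commutes
  refine ⟨⟨_, hV.fromSpec, inferInstance, g.comp σ.toRingEquiv.toRingHom,
    RingHom.Etale.respectsIso.right _ _ hg, ?_⟩, by rwa [hV.range_fromSpec]⟩
  rw [RingHom.comp_assoc, hσC, hgC,
    ← IsAffineOpen.SpecMap_appLE_fromSpec p (isAffineOpen_top _) hV e,
    IsAffineOpen.fromSpec_top, Scheme.isoSpec_Spec_inv, ← Spec.map_comp]
  rfl

theorem exists_range_subset [SmoothOfRelativeDimension 1 p] {x : X} {W : X.Opens} (hx : x ∈ W) :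
    ∃ c : EtaleChart p, x ∈ Set.range c.j ∧ Set.range c.j ⊆ W := by
  have : SmoothOfRelativeDimension 1 (W.ι ≫ p) :=
    inferInstanceAs (SmoothOfRelativeDimension (0 + 1) (W.ι ≫ p))
  obtain ⟨c, y, hy⟩ := exists_mem_range (W.ι ≫ p) ⟨x, hx⟩
  have := c.isOpenImmersion
  refine ⟨⟨c.B, c.j ≫ W.ι, inferInstance, c.g, c.etale, by rw [Category.assoc, c.comp]⟩,
    ⟨y, by rw [Scheme.Hom.comp_apply, hy]; rfl⟩, ?_⟩
  rintro _ ⟨z, rfl⟩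
  rw [Scheme.Hom.comp_apply]
  exact (c.j z).2

end Existence

noncomputable section

variable {k : Type u} [Field k] {X : Scheme.{u}} {p : X ⟶ Spec (.of k)} (c : EtaleChart p)

instance : IsOpenImmersion c.j := c.isOpenImmersion
instance : Algebra k[X] c.B := c.g.toAlgebra
instance : Algebra k c.B := (c.g.comp C).toAlgebra
instance : IsScalarTower k k[X] c.B := .of_algebraMap_eq' rfl
instance : Algebra.Etale k[X] c.B := c.etale

theorem isReduced : _root_.IsReduced c.B := isReduced_of_etale k[X] c.B

theorem isDomain [IrreducibleSpace X] [Nonempty (Spec c.B)] : IsDomain c.B := by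
  have hpre : IsPreirreducible (Set.univ : Set (PrimeSpectrum c.B)) :=
    PreirreducibleSpace.isPreirreducible_univ.preimage c.j.isOpenEmbedding
  have : IrreducibleSpace (PrimeSpectrum c.B) :=
    { isPreirreducible_univ := hpre, toNonempty := inferInstanceAs (Nonempty (Spec c.B)) }
  exact isDomain_of_etale k[X] c.B

theorem isDomain_of_mem_range [IrreducibleSpace X] {x : X} (hx : x ∈ Set.range c.j) :
    IsDomain c.B :=
  have : Nonempty (Spec c.B) := ⟨hx.choose⟩
  c.isDomain

theorem j_bot [IrreducibleSpace X] [IsDomain c.B] :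
    c.j (⊥ : PrimeSpectrum c.B) = genericPoint X := by
  rw [← genericPoint_eq_of_isOpenImmersion c.j, genericPoint_eq_bot_of_affine]

/-- The coordinate function `t` of an étale chart. -/
def coord : c.B := algebraMap k[X] c.B Polynomial.X

variable {K : Type u} [Field K] [Algebra k K]

/-- The `K`-point attached to a homomorphism from the coordinate ring of a chart. -/
def toKPoint (h : c.B →ₐ[k] K) : KPoint K p :=
  ⟨Spec.map (CommRingCat.ofHom h.toRingHom) ≫ c.j, by
    rw [Category.assoc, c.comp, ← Spec.map_comp, ← CommRingCat.ofHom_comp]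
    exact congrArg (fun φ => Spec.map (CommRingCat.ofHom φ)) h.comp_algebraMap⟩

theorem toKPoint_injective : Function.Injective (c.toKPoint (K := K)) := by
  intro h₁ h₂ h
  have hSpec := congrArg Subtype.val h
  simp only [toKPoint, cancel_mono] at hSpec
  exact AlgHom.coe_ringHom_injective (congrArg CommRingCat.Hom.hom (Spec.map_injective hSpec))

theorem pt_toKPoint (h : c.B →ₐ[k] K) :
    (c.toKPoint h).pt = c.j ⟨RingHom.ker h, RingHom.ker_isPrime _⟩ := by
  refine congrArg c.j (PrimeSpectrum.ext ?_)
  change (IsLocalRing.maximalIdeal K).comap h.toRingHom = _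
  rw [IsLocalRing.isField_iff_maximalIdeal_eq.1 (Field.toIsField K)]
  rfl

theorem exists_toKPoint_eq {x : KPoint K p} (hx : x.pt ∈ Set.range c.j) :
    ∃ h : c.B →ₐ[k] K, c.toKPoint h = x := by
  obtain ⟨φ, hφ⟩ := Spec.map_surjective (IsOpenImmersion.lift c.j x.1 (x.range_subset hx))
  have hfac : Spec.map φ ≫ c.j = x.1 := by
    rw [hφ]
    exact IsOpenImmersion.lift_fac _ _ _
  have hk : φ.hom.comp (c.g.comp C) = algebraMap k K := by
    have hx2 := x.2
    rw [← hfac, Category.assoc, c.comp, ← Spec.map_comp] at hx2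
    exact congrArg CommRingCat.Hom.hom (Spec.map_injective hx2)
  exact ⟨⟨φ.hom, fun r => congr($hk r)⟩, Subtype.ext hfac⟩

/-- The value of the coordinate function at the `K`-points of the chart, extended by the junk value
`0` to the other `K`-points of `X`. -/
def coordinate : KPoint K p → K :=
  Function.extend c.toKPoint (fun h => h c.coord) 0

theorem coordinate_toKPoint (h : c.B →ₐ[k] K) : c.coordinate (c.toKPoint h) = h c.coord :=
  c.toKPoint_injective.extend_apply _ _ h

theorem finite_compl_range_coordinate [Nontrivial c.B] [IsAlgClosed K] :
    (Set.range (c.coordinate (K := K)))ᶜ.Finite := by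
  refine (finite_setOf_forall_algHom_ne k c.B K).subset fun a ha h hh => ha ⟨c.toKPoint h, ?_⟩
  rw [coordinate_toKPoint]
  exact hh

theorem transcendental_coord [Nontrivial c.B] : Transcendental k c.coord :=
  transcendental_algebraMap_X k c.B

variable {c} {Y : Scheme.{u}} {q : Y ⟶ Spec (.of k)} {c₀ : EtaleChart q} {f : X ⟶ Y}

theorem exists_algHom_comp_eq (hf : f ≫ q = p) (hrange : Set.range (c.j ≫ f) ⊆ Set.range c₀.j) :
    ∃ φ : c₀.B →ₐ[k] c.B, Spec.map (CommRingCat.ofHom φ.toRingHom) ≫ c₀.j = c.j ≫ f := by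
  obtain ⟨φ, hφ⟩ := Spec.map_surjective (IsOpenImmersion.lift c₀.j (c.j ≫ f) hrange)
  have hfac : Spec.map φ ≫ c₀.j = c.j ≫ f := by
    rw [hφ]
    exact IsOpenImmersion.lift_fac _ _ _
  have hk : φ.hom.comp (c₀.g.comp C) = c.g.comp C := by
    have hSpec : Spec.map φ ≫ c₀.j ≫ q = Spec.map (CommRingCat.ofHom (c.g.comp C)) := by
      rw [← Category.assoc, hfac, Category.assoc, hf, c.comp]
    rw [c₀.comp, ← Spec.map_comp] at hSpec
    exact congrArg CommRingCat.Hom.hom (Spec.map_injective hSpec)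
  exact ⟨⟨φ.hom, fun r => congr($hk r)⟩, hfac⟩

theorem algHom_injective [IrreducibleSpace X] [IrreducibleSpace Y] [IsDomain c.B] [IsDomain c₀.B]
    (hf : f (genericPoint X) = genericPoint Y) {φ : c₀.B →ₐ[k] c.B}
    (hφ : Spec.map (CommRingCat.ofHom φ.toRingHom) ≫ c₀.j = c.j ≫ f) :
    Function.Injective φ := by
  have hbot : c₀.j (Spec.map (CommRingCat.ofHom φ.toRingHom) (⊥ : PrimeSpectrum c.B)) =
      c₀.j (⊥ : PrimeSpectrum c₀.B) := by
    rw [c₀.j_bot, ← hf, ← c.j_bot]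
    exact congr($hφ (⊥ : PrimeSpectrum c.B))
  exact (RingHom.injective_iff_ker_eq_bot φ.toRingHom).2
    (congrArg PrimeSpectrum.asIdeal (c₀.j.isOpenEmbedding.injective hbot))

theorem map_toKPoint (hf : f ≫ q = p) {φ : c₀.B →ₐ[k] c.B}
    (hφ : Spec.map (CommRingCat.ofHom φ.toRingHom) ≫ c₀.j = c.j ≫ f) (h : c.B →ₐ[k] K) :
    KPoint.map K f hf (c.toKPoint h) = c₀.toKPoint (h.comp φ) := by
  refine Subtype.ext ?_
  change (Spec.map (CommRingCat.ofHom h.toRingHom) ≫ c.j) ≫ f = _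
  rw [Category.assoc, ← hφ, ← Category.assoc, ← Spec.map_comp]
  rfl

end

end EtaleChart

end EtaleChart

section Curve

variable {k : Type u} [Field k] {X Y : Scheme.{u}}

theorem finite_of_forall_exists_mem_nhds {α X : Type*} [TopologicalSpace X] [CompactSpace X]
    (f : α → X) {S : Set α} (h : ∀ x, ∃ U ∈ nhds x, (S ∩ f ⁻¹' U).Finite) : S.Finite := by
  choose U hU hfin using h
  obtain ⟨t, ht⟩ := CompactSpace.elim_nhds_subcover U hU
  refine (t.finite_toSet.biUnion fun x _ => hfin x).subset fun z hz => ?_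
  obtain ⟨x, hx, hzx⟩ := Set.mem_iUnion₂.1 (ht.ge (Set.mem_univ (f z)))
  exact Set.mem_biUnion hx ⟨hz, hzx⟩

theorem genericPoint_mem [IrreducibleSpace X] {V : X.Opens} (hV : (V : Set X).Nonempty) :
    genericPoint X ∈ V :=
  (genericPoint_specializes hV.some).mem_open V.2 hV.some_mem

theorem IsCurve.irreducibleSpace {p : X ⟶ Spec (.of k)} (hp : IsCurve p) : IrreducibleSpace X := by
  have := hp.irreducible
  have : Subsingleton (Spec (.of k)) := inferInstanceAs (Subsingleton (PrimeSpectrum k))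
  have : Nonempty (Spec (.of k)) := inferInstanceAs (Nonempty (PrimeSpectrum k))
  exact GeometricallyIrreducible.irreducibleSpace_of_subsingleton p

theorem IsCurve.compactSpace {p : X ⟶ Spec (.of k)} (hp : IsCurve p) : CompactSpace X := by
  have := hp.proper
  exact QuasiCompact.compactSpace_of_compactSpace p

theorem isIntegral_of_smoothOfRelativeDimension_one (p : X ⟶ Spec (.of k)) [IrreducibleSpace X]
    [SmoothOfRelativeDimension 1 p] : IsIntegral X := by
  have (x : X) : _root_.IsReduced (X.presheaf.stalk x) := by
    obtain ⟨c, y, rfl⟩ := EtaleChart.exists_mem_range p x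
    have := c.isReduced
    exact isReduced_of_injective (c.j.stalkMap y).hom
      (ConcreteCategory.bijective_of_isIso (c.j.stalkMap y)).1
  have : IsReduced X := isReduced_of_isReduced_stalk X
  exact isIntegral_of_irreducibleSpace_of_isReduced X

theorem eq_genericPoint_or_eq_of_specializes (p : X ⟶ Spec (.of k)) [IrreducibleSpace X]
    [SmoothOfRelativeDimension 1 p] {x x' : X} (h : x ⤳ x') : x = genericPoint X ∨ x = x' := by
  obtain ⟨c, y', rfl⟩ := EtaleChart.exists_mem_range p x'
  obtain ⟨y, rfl⟩ := h.mem_open c.j.isOpenEmbedding.isOpen_range ⟨y', rfl⟩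
  have := c.isDomain_of_mem_range ⟨y, rfl⟩
  have := dimensionLEOne_of_quasiFinite_of_flat (Polynomial k) c.B
  have hle : y.asIdeal ≤ y'.asIdeal :=
    (PrimeSpectrum.le_iff_specializes y y').2 (c.j.isOpenEmbedding.isInducing.specializes_iff.1 h)
  by_cases hy : y.asIdeal = ⊥
  · exact .inl (.trans (congrArg c.j (PrimeSpectrum.ext hy)) c.j_bot)
  · have hmax : y.asIdeal.IsMaximal := Ring.DimensionLEOne.maximalOfPrime hy y.2
    exact .inr (congrArg c.j (PrimeSpectrum.ext (hmax.eq_of_le y'.2.ne_top hle)))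

theorem map_genericPoint_of_isNonconstant (q : Y ⟶ Spec (.of k)) [IrreducibleSpace X]
    [IrreducibleSpace Y] [SmoothOfRelativeDimension 1 q] {f : X ⟶ Y} (hf : IsNonconstant f) :
    f (genericPoint X) = genericPoint Y := by
  by_contra hne
  refine hf ⟨f (genericPoint X), fun x => ?_⟩
  have hspec : f (genericPoint X) ⤳ f x := (genericPoint_specializes x).map f.continuous
  exact ((eq_genericPoint_or_eq_of_specializes q hspec).resolve_left hne).symm

theorem finite_setOf_pt_notMem (p : X ⟶ Spec (.of k)) [IrreducibleSpace X] [CompactSpace X]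
    [SmoothOfRelativeDimension 1 p] (K : Type u) [Field K] [Algebra k K] {V : X.Opens}
    (hV : (V : Set X).Nonempty) : {x : KPoint K p | x.pt ∉ V}.Finite := by
  refine finite_of_forall_exists_mem_nhds KPoint.pt fun x => ?_
  obtain ⟨c, hx⟩ := EtaleChart.exists_mem_range p x
  refine ⟨Set.range c.j, c.j.isOpenEmbedding.isOpen_range.mem_nhds hx, ?_⟩
  have := c.isDomain_of_mem_range hx
  have hbot : (⊥ : PrimeSpectrum c.B) ∈ c.j ⁻¹' V := by
    change c.j (⊥ : PrimeSpectrum c.B) ∈ V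
    rw [c.j_bot]
    exact genericPoint_mem hV
  obtain ⟨_, ⟨_, ⟨b, rfl⟩, rfl⟩, hb, hbV⟩ :=
    PrimeSpectrum.isBasis_basic_opens.exists_subset_of_mem_open hbot (V.2.preimage c.j.continuous)
  refine ((finite_setOf_algHom_apply_eq_zero K (b := b) hb).image c.toKPoint).subset ?_
  rintro z ⟨hzV, hz⟩
  obtain ⟨h, rfl⟩ := c.exists_toKPoint_eq hz
  refine ⟨h, by_contra fun hhb => hzV ?_, rfl⟩
  rw [c.pt_toKPoint]
  exact hbV hhb

end Curve

/-! ### Ramification -/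

section Unramified

theorem formallyUnramified_stalkMap_iff {X Y : Scheme.{u}} {f : X ⟶ Y} {x : X} {U : Y.Opens}
    (hU : IsAffineOpen U) {V : X.Opens} (hV : IsAffineOpen V) (hVU : V ≤ f ⁻¹ᵁ U) (hx : x ∈ V) :
    letI := (f.appLE U V hVU).hom.toAlgebra
    (f.stalkMap x).hom.FormallyUnramified ↔
      hV.primeIdealOf ⟨x, hx⟩ ∈ Algebra.unramifiedLocus Γ(Y, U) Γ(X, V) := by
  let := (f.appLE U V hVU).hom.toAlgebra
  let P := (hU.primeIdealOf ⟨f x, hVU hx⟩).asIdeal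
  let Q := (hV.primeIdealOf ⟨x, hx⟩).asIdeal
  have : Q.LiesOver P :=
    ⟨congr($(IsAffineOpen.comap_primeIdealOf_appLE U hU V hV hVU hx).1).symm⟩
  let := Localization.AtPrime.algebraOfLiesOver P Q
  trans Algebra.FormallyUnramified (Localization.AtPrime P) (Localization.AtPrime Q)
  · rw [← RingHom.formallyUnramified_algebraMap]
    exact RingHom.FormallyUnramified.respectsIso.arrow_mk_iso_iff
      (IsAffineOpen.arrowStalkMapIso f U hU V hV hVU hx)
  · exact ⟨fun _ => Algebra.FormallyUnramified.comp Γ(Y, U) (Localization.AtPrime P) _,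
      fun h => have : Algebra.FormallyUnramified Γ(Y, U) (Localization.AtPrime Q) := h
        .of_restrictScalars Γ(Y, U) _ _⟩

theorem isOpen_setOf_formallyUnramified_stalkMap {X Y : Scheme.{u}} (f : X ⟶ Y)
    [LocallyOfFiniteType f] : IsOpen {x | (f.stalkMap x).hom.FormallyUnramified} := by
  refine isOpen_iff_forall_mem_open.2 fun x hx => ?_
  obtain ⟨_, ⟨U, hU, rfl⟩, hxU, -⟩ :=
    Y.isBasis_affineOpens.exists_subset_of_mem_open (Set.mem_univ (f x)) isOpen_univ
  obtain ⟨_, ⟨V, hV, rfl⟩, hxV, hVU⟩ :=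
    X.isBasis_affineOpens.exists_subset_of_mem_open hxU (U.2.preimage f.continuous)
  have := f.finiteType_appLE hU hV hVU
  have := hV.isOpenImmersion_fromSpec
  algebraize [(f.appLE U V hVU).hom]
  refine ⟨hV.fromSpec '' Algebra.unramifiedLocus Γ(Y, U) Γ(X, V), ?_,
    hV.fromSpec.isOpenEmbedding.isOpenMap _ Algebra.isOpen_unramifiedLocus,
    ⟨_, (formallyUnramified_stalkMap_iff hU hV hVU hxV).1 hx, hV.fromSpec_primeIdealOf ⟨x, hxV⟩⟩⟩
  rintro _ ⟨Q, hQ, rfl⟩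
  have hQV : hV.fromSpec Q ∈ V := hV.range_fromSpec.le ⟨Q, rfl⟩
  refine (formallyUnramified_stalkMap_iff hU hV hVU hQV).2 ?_
  rwa [hV.fromSpec.isOpenEmbedding.injective (hV.fromSpec_primeIdealOf ⟨_, hQV⟩)]

theorem formallyUnramified_stalkMap_comp_iff {W X Y : Scheme.{u}} (i : W ⟶ X) [IsOpenImmersion i]
    (f : X ⟶ Y) (w : W) :
    ((i ≫ f).stalkMap w).hom.FormallyUnramified ↔
      (f.stalkMap (i w)).hom.FormallyUnramified := by
  rw [Scheme.Hom.stalkMap_comp]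
  exact RingHom.FormallyUnramified.respectsIso.cancel_right_isIso _ (i.stalkMap w)

theorem exists_formallyUnramified_ι_comp {X Y : Scheme.{u}} (f : X ⟶ Y) [LocallyOfFiniteType f]
    {x : X} (hx : (f.stalkMap x).hom.FormallyUnramified) :
    ∃ U : X.Opens, x ∈ U ∧ FormallyUnramified (U.ι ≫ f) :=
  ⟨⟨_, isOpen_setOf_formallyUnramified_stalkMap f⟩, hx,
    HasRingHomProperty.of_stalkMap RingHom.FormallyUnramified.ofLocalizationPrime fun w =>
      (formallyUnramified_stalkMap_comp_iff _ f w).2 w.2⟩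

theorem formallyUnramified_stalkMap_genericPoint {X Y : Scheme.{u}} [IsIntegral X] [IsIntegral Y]
    {f : X ⟶ Y} (hf : f (genericPoint X) = genericPoint Y) (hsep : IsSeparableMorphism f) :
    (f.stalkMap (genericPoint X)).hom.FormallyUnramified := by
  let := (f.stalkMap (genericPoint X)).hom.toAlgebra
  have hY : IsField (Y.presheaf.stalk (f (genericPoint X))) := by
    rw [hf]
    exact Field.toIsField Y.functionField
  let := hY.toField
  let : Field (X.presheaf.stalk (genericPoint X)) := inferInstanceAs (Field X.functionField)
  have := hsep (genericPoint X) (genericPoint_spec X)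
  exact Algebra.FormallyUnramified.of_isSeparable (Y.presheaf.stalk (f (genericPoint X))) _

theorem ramificationIndexAt_eq_one {X Y : Scheme.{u}} (f : X ⟶ Y) [LocallyOfFiniteType f] {x : X}
    (hx : (f.stalkMap x).hom.FormallyUnramified) : ramificationIndexAt f x = 1 := by
  unfold ramificationIndexAt
  let := (f.stalkMap x).hom.toAlgebra
  have : Algebra.EssFiniteType (Y.presheaf.stalk (f x)) (X.presheaf.stalk x) :=
    LocallyOfFiniteType.stalkMap f x
  have : Algebra.FormallyUnramified (Y.presheaf.stalk (f x)) (X.presheaf.stalk x) := hx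
  let m := IsLocalRing.maximalIdeal (X.presheaf.stalk x)
  have : Algebra.FormallyUnramified (X.presheaf.stalk x) (Localization.AtPrime m) :=
    .of_isLocalization m.primeCompl
  have : Algebra.IsUnramifiedAt (Y.presheaf.stalk (f x)) m :=
    Algebra.FormallyUnramified.comp _ (X.presheaf.stalk x) _
  exact Ideal.ramificationIdx_eq_one m (Y.presheaf.stalk (f x))

end Unramified

section BaseChange

variable {k : Type u} [Field k] (K : Type u) [Field K] [Algebra k K] {W X Y : Scheme.{u}}
  {p : X ⟶ Spec (.of k)} {q : Y ⟶ Spec (.of k)} {r : W ⟶ Spec (.of k)}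

theorem baseChangeMap_fst (f : X ⟶ Y) (hf : f ≫ q = p) :
    baseChangeMap K f hf ≫ pullback.fst q (baseMap K) = pullback.fst p (baseMap K) ≫ f :=
  pullback.lift_fst _ _ _

theorem baseChangeMap_snd (f : X ⟶ Y) (hf : f ≫ q = p) :
    baseChangeMap K f hf ≫ pullback.snd q (baseMap K) = pullback.snd p (baseMap K) :=
  (pullback.lift_snd _ _ _).trans (Category.comp_id _)

theorem isPullback_baseChangeMap (f : X ⟶ Y) (hf : f ≫ q = p) :
    IsPullback (pullback.fst p (baseMap K)) (baseChangeMap K f hf) f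
      (pullback.fst q (baseMap K)) := by
  refine (IsPullback.of_right ?_ (baseChangeMap_fst K f hf)
    (IsPullback.of_hasPullback q (baseMap (k := k) K)).flip).flip
  rw [baseChangeMap_snd, hf]
  exact (IsPullback.of_hasPullback p (baseMap (k := k) K)).flip

theorem baseChangeMap_comp (i : W ⟶ X) (f : X ⟶ Y) (hi : i ≫ p = r) (hf : f ≫ q = p) :
    baseChangeMap K (i ≫ f) (by rw [Category.assoc, hf, hi]) =
      baseChangeMap K i hi ≫ baseChangeMap K f hf := by
  apply pullback.hom_ext
  · simp only [Category.assoc, baseChangeMap_fst]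
    rw [← Category.assoc, ← Category.assoc, baseChangeMap_fst]
  · simp only [Category.assoc, baseChangeMap_snd]

variable {K}

theorem KPoint.toBaseChange_map (i : W ⟶ X) (hi : i ≫ p = r) (x : KPoint K r) :
    (KPoint.map K i hi x).toBaseChange = baseChangeMap K i hi x.toBaseChange := by
  have hlift : pullback.lift (x.1 ≫ i) (𝟙 (Spec (.of K))) (by simp [hi, x.2]) =
      pullback.lift x.1 (𝟙 (Spec (.of K))) (by simp [x.2]) ≫ baseChangeMap K i hi := by
    apply pullback.hom_ext
    · refine (pullback.lift_fst _ _ _).trans ?_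
      rw [Category.assoc, baseChangeMap_fst, pullback.lift_fst_assoc]
    · refine (pullback.lift_snd _ _ _).trans ?_
      rw [Category.assoc, baseChangeMap_snd, pullback.lift_snd]
  exact congr($hlift (IsLocalRing.closedPoint K))

theorem KPoint.exists_map_eq (i : W ⟶ X) [IsOpenImmersion i] (hi : i ≫ p = r) {x : KPoint K p}
    (hx : x.pt ∈ Set.range i) : ∃ y : KPoint K r, KPoint.map K i hi y = x := by
  have hrange : Set.range x.1 ⊆ Set.range i := x.range_subset hx
  have hfac := IsOpenImmersion.lift_fac i x.1 hrange
  refine ⟨⟨IsOpenImmersion.lift i x.1 hrange, ?_⟩, Subtype.ext hfac⟩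
  rw [← hi, ← Category.assoc, hfac, x.2]

theorem KPoint.finite_setOf_of_locally [CompactSpace X] {P : KPoint K p → Prop}
    (h : ∀ x : X, ∃ U : X.Opens, x ∈ U ∧
      {y : KPoint K (U.ι ≫ p) | P (KPoint.map K U.ι rfl y)}.Finite) : {z | P z}.Finite := by
  refine finite_of_forall_exists_mem_nhds KPoint.pt fun x => ?_
  obtain ⟨U, hxU, hfin⟩ := h x
  refine ⟨U, U.2.mem_nhds hxU, (hfin.image (KPoint.map K U.ι rfl)).subset ?_⟩
  rintro z ⟨hz, hzU⟩
  obtain ⟨y, rfl⟩ := KPoint.exists_map_eq U.ι rfl (x := z) (by rwa [Scheme.Opens.range_ι])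
  exact ⟨y, hz, rfl⟩

theorem ramificationIndexAt_baseChangeMap_eq_one (i : W ⟶ X) [IsOpenImmersion i] (f : X ⟶ Y)
    (hf : f ≫ q = p) [LocallyOfFiniteType f] [FormallyUnramified (i ≫ f)] {x : KPoint K p}
    (hx : x.pt ∈ Set.range i) :
    ramificationIndexAt (baseChangeMap K f hf) x.toBaseChange = 1 := by
  obtain ⟨y, rfl⟩ := KPoint.exists_map_eq i rfl hx
  have : LocallyOfFiniteType (baseChangeMap K f hf) :=
    MorphismProperty.of_isPullback (isPullback_baseChangeMap K f hf) ‹_›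
  have : IsOpenImmersion (baseChangeMap K i (rfl : i ≫ p = _)) :=
    MorphismProperty.of_isPullback (isPullback_baseChangeMap K i _) ‹_›
  have : FormallyUnramified (baseChangeMap K i (rfl : i ≫ p = _) ≫ baseChangeMap K f hf) := by
    rw [← baseChangeMap_comp]
    exact MorphismProperty.of_isPullback (isPullback_baseChangeMap K (i ≫ f) _) ‹_›
  rw [KPoint.toBaseChange_map]
  exact ramificationIndexAt_eq_one _
    ((formallyUnramified_stalkMap_comp_iff _ _ _).1 (FormallyUnramified.stalkMap _ _))

end BaseChange

/-! ### Self-correspondences -/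

section CurveMorphism

variable {k : Type u} [Field k] {W X Y : Scheme.{u}} {p : X ⟶ Spec (.of k)} {q : Y ⟶ Spec (.of k)}
  (K : Type u) [Field K] [Algebra k K]

theorem finite_setOf_ramificationIndexAt_baseChangeMap_ne_one [IrreducibleSpace W] [CompactSpace W]
    [IrreducibleSpace Y] (i : W ⟶ X) [IsOpenImmersion i] [SmoothOfRelativeDimension 1 (i ≫ p)]
    [SmoothOfRelativeDimension 1 q] (f : X ⟶ Y) (hf : f ≫ q = p) [LocallyOfFiniteType f]
    (hnc : IsNonconstant (i ≫ f)) (hsep : IsSeparableMorphism (i ≫ f)) :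
    {w : KPoint K (i ≫ p) | ramificationIndexAt (baseChangeMap K f hf)
      (KPoint.map K i rfl w).toBaseChange ≠ 1}.Finite := by
  have := isIntegral_of_smoothOfRelativeDimension_one (i ≫ p)
  have := isIntegral_of_smoothOfRelativeDimension_one q
  obtain ⟨V, hV, hunr⟩ := exists_formallyUnramified_ι_comp (i ≫ f)
    (formallyUnramified_stalkMap_genericPoint (map_genericPoint_of_isNonconstant q hnc) hsep)
  refine (finite_setOf_pt_notMem (i ≫ p) K ⟨_, hV⟩).subset fun w hw hwV => hw ?_
  have : FormallyUnramified ((V.ι ≫ i) ≫ f) := by rwa [Category.assoc]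
  exact ramificationIndexAt_baseChangeMap_eq_one (V.ι ≫ i) f hf ⟨⟨w.pt, hwV⟩, rfl⟩

variable {K} in
open Polynomial in
theorem EtaleChart.exists_finite_setOf_not_polyRelated [IrreducibleSpace X] [CompactSpace X]
    [IrreducibleSpace Y] [SmoothOfRelativeDimension 1 p] [SmoothOfRelativeDimension 1 q]
    (c₀ : EtaleChart q) [IsDomain c₀.B] {f₁ f₂ : X ⟶ Y} (hf₁ : f₁ ≫ q = p) (hf₂ : f₂ ≫ q = p)
    (h₁ : IsNonconstant f₁) (h₂ : IsNonconstant f₂) :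
    ∃ F : k[X][X], {x : KPoint K p | ¬ PolyRelated {F} (c₀.coordinate (KPoint.map K f₁ hf₁ x))
      (c₀.coordinate (KPoint.map K f₂ hf₂ x))}.Finite := by
  have hη₁ := map_genericPoint_of_isNonconstant q h₁
  have hη₂ := map_genericPoint_of_isNonconstant q h₂
  obtain ⟨c, hη, hc⟩ := EtaleChart.exists_range_subset p (x := genericPoint X)
    (W := f₁ ⁻¹ᵁ c₀.j.opensRange ⊓ f₂ ⁻¹ᵁ c₀.j.opensRange)
    ⟨⟨(⊥ : PrimeSpectrum c₀.B), c₀.j_bot.trans hη₁.symm⟩,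
      ⟨(⊥ : PrimeSpectrum c₀.B), c₀.j_bot.trans hη₂.symm⟩⟩
  have := c.isDomain_of_mem_range hη
  obtain ⟨φ₁, hφ₁⟩ := EtaleChart.exists_algHom_comp_eq (c := c) (c₀ := c₀) hf₁
    (Set.range_subset_iff.2 fun y => (hc ⟨y, rfl⟩).1)
  obtain ⟨φ₂, hφ₂⟩ := EtaleChart.exists_algHom_comp_eq (c := c) (c₀ := c₀) hf₂
    (Set.range_subset_iff.2 fun y => (hc ⟨y, rfl⟩).2)
  have htr : Transcendental k (φ₁ c₀.coord) :=
    mt (isAlgebraic_algHom_iff φ₁ (algHom_injective hη₁ hφ₁)).1 c₀.transcendental_coord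
  obtain ⟨F, b, hb, hF⟩ := exists_forall_polyRelated (trdeg_eq_one_of_quasiFinite_polynomial k c.B)
    htr (φ₂ c₀.coord) K
  have hfin := finite_setOf_pt_notMem p K (V := c.j ''ᵁ PrimeSpectrum.basicOpen b)
    ⟨_, (⊥ : PrimeSpectrum c.B), hb, rfl⟩
  refine ⟨F, hfin.subset fun x hx hxV => hx ?_⟩
  obtain ⟨y, hyb, hyx⟩ := hxV
  obtain ⟨h, rfl⟩ := c.exists_toKPoint_eq ⟨y, hyx⟩
  rw [pt_toKPoint] at hyx
  obtain rfl := c.j.isOpenEmbedding.injective hyx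
  rw [map_toKPoint hf₁ hφ₁, map_toKPoint hf₂ hφ₂, coordinate_toKPoint, coordinate_toKPoint]
  exact hF h hyb

end CurveMorphism

namespace SelfCorrespondence

variable {k : Type u} [Field k] {C : Scheme.{u}} {p : C ⟶ Spec (.of k)}
  (𝒟 : SelfCorrespondence p) (K : Type u) [Field K] [Algebra k K]

theorem compactSpace : CompactSpace 𝒟.D := by
  have := 𝒟.proper
  exact QuasiCompact.compactSpace_of_compactSpace 𝒟.str

theorem locallyOfFiniteType_of_comp_eq {f : 𝒟.D ⟶ C} (hf : f ≫ p = 𝒟.str) :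
    LocallyOfFiniteType f := by
  have := 𝒟.proper
  have : LocallyOfFiniteType (f ≫ p) := hf ▸ inferInstance
  exact locallyOfFiniteType_of_comp f p

theorem exists_component (x : 𝒟.D) : ∃ U : 𝒟.D.Opens, x ∈ U ∧ IsCurve (U.ι ≫ 𝒟.str) ∧
    IsNonconstant (U.ι ≫ 𝒟.π₁) ∧ IsSeparableMorphism (U.ι ≫ 𝒟.π₁) ∧
    IsNonconstant (U.ι ≫ 𝒟.π₂) ∧ IsSeparableMorphism (U.ι ≫ 𝒟.π₂) := by
  obtain ⟨U, hU, h⟩ := 𝒟.component x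
  exact ⟨U, hU.ge mem_connectedComponent, h⟩

open Polynomial

variable {K} in
/-- The coordinates of the two endpoints of the edge `z` are related, in both orders, by one of the
bivariate polynomials in `E`. -/
def IsPolyRelatedEdge (c₀ : EtaleChart p) (E : Set k[X][X]) (z : (𝒟.graph K).Z) : Prop :=
  PolyRelated E (c₀.coordinate ((𝒟.graph K).s z)) (c₀.coordinate ((𝒟.graph K).t z)) ∧
    PolyRelated E (c₀.coordinate ((𝒟.graph K).t z)) (c₀.coordinate ((𝒟.graph K).s z))

variable {𝒟 K} in
theorem IsPolyRelatedEdge.mono {c₀ : EtaleChart p} {E E' : Set k[X][X]} {z : (𝒟.graph K).Z}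
    (h : E ⊆ E') (hz : 𝒟.IsPolyRelatedEdge c₀ E z) : 𝒟.IsPolyRelatedEdge c₀ E' z :=
  ⟨hz.1.mono h, hz.2.mono h⟩

variable [IrreducibleSpace C] [SmoothOfRelativeDimension 1 p]

theorem exists_open_finite_setOf_not_isPolyRelatedEdge (c₀ : EtaleChart p) [IsDomain c₀.B]
    (x : 𝒟.D) : ∃ (U : 𝒟.D.Opens) (E : Set k[X][X]), x ∈ U ∧ E.Finite ∧
      {w : KPoint K (U.ι ≫ 𝒟.str) |
        ¬ 𝒟.IsPolyRelatedEdge c₀ E (KPoint.map K U.ι rfl w)}.Finite := by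
  obtain ⟨U, hxU, hU, h₁, -, h₂, -⟩ := 𝒟.exists_component x
  have := hU.irreducibleSpace
  have := hU.compactSpace
  have := hU.smooth
  have hπ₁ : (U.ι ≫ 𝒟.π₁) ≫ p = U.ι ≫ 𝒟.str := by rw [Category.assoc, 𝒟.comp_π₁]
  have hπ₂ : (U.ι ≫ 𝒟.π₂) ≫ p = U.ι ≫ 𝒟.str := by rw [Category.assoc, 𝒟.comp_π₂]
  obtain ⟨F, hF⟩ := c₀.exists_finite_setOf_not_polyRelated (K := K) hπ₁ hπ₂ h₁ h₂
  obtain ⟨G, hG⟩ := c₀.exists_finite_setOf_not_polyRelated (K := K) hπ₂ hπ₁ h₂ h₁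
  refine ⟨U, {F, G}, hxU, Set.toFinite _, (hF.union hG).subset fun w hw => ?_⟩
  exact (not_and_or.1 hw).imp (mt (.mono (Set.singleton_subset_iff.2 (.inl rfl))))
    (mt (.mono (Set.singleton_subset_iff.2 (.inr rfl))))

theorem exists_finite_setOf_not_isPolyRelatedEdge (c₀ : EtaleChart p) [IsDomain c₀.B] :
    ∃ E : Set k[X][X], E.Finite ∧
      {z : (𝒟.graph K).Z | ¬ 𝒟.IsPolyRelatedEdge c₀ E z}.Finite := by
  have := 𝒟.compactSpace
  choose U E hxU hE hfin using 𝒟.exists_open_finite_setOf_not_isPolyRelatedEdge K c₀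
  obtain ⟨t, ht⟩ := CompactSpace.elim_nhds_subcover (fun x => (U x : Set 𝒟.D))
    fun x => (U x).2.mem_nhds (hxU x)
  refine ⟨⋃ x ∈ t, E x, t.finite_toSet.biUnion fun x _ => hE x,
    KPoint.finite_setOf_of_locally fun x' => ?_⟩
  obtain ⟨x, hxt, hx⟩ := Set.mem_iUnion₂.1 (ht.ge (Set.mem_univ x'))
  exact ⟨U x, hx, (hfin x).subset fun w => mt (.mono (Set.subset_biUnion_of_mem hxt))⟩

theorem infinite_setOf_isIrreducibleComplete [IsAlgClosed K] :
    {S : Set (𝒟.graph K).V | (𝒟.graph K).IsIrreducibleComplete S}.Infinite := by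
  obtain ⟨c₀, hc₀⟩ := EtaleChart.exists_mem_range p (genericPoint C)
  have := c₀.isDomain_of_mem_range hc₀
  obtain ⟨E, hE, hfin⟩ := 𝒟.exists_finite_setOf_not_isPolyRelatedEdge K c₀
  exact DirectedGraph.infinite_setOf_isIrreducibleComplete (Γ := 𝒟.graph K)
    c₀.finite_compl_range_coordinate hE (hfin.subset fun z hz h => hz h.1)
    (hfin.subset fun z hz h => hz h.2)

theorem finite_setOf_not_isEtaleEdge : {z : (𝒟.graph K).Z | ¬ 𝒟.IsEtaleEdge K z}.Finite := by
  have := 𝒟.compactSpace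
  have := 𝒟.locallyOfFiniteType_of_comp_eq 𝒟.comp_π₁
  have := 𝒟.locallyOfFiniteType_of_comp_eq 𝒟.comp_π₂
  refine KPoint.finite_setOf_of_locally fun x => ?_
  obtain ⟨U, hxU, hU, hnc₁, hsep₁, hnc₂, hsep₂⟩ := 𝒟.exists_component x
  have := hU.irreducibleSpace
  have := hU.compactSpace
  have := hU.smooth
  have hfin₁ := finite_setOf_ramificationIndexAt_baseChangeMap_ne_one K U.ι 𝒟.π₁ 𝒟.comp_π₁
    hnc₁ hsep₁
  have hfin₂ := finite_setOf_ramificationIndexAt_baseChangeMap_ne_one K U.ι 𝒟.π₂ 𝒟.comp_π₂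
    hnc₂ hsep₂
  exact ⟨U, hxU, (hfin₁.union hfin₂).subset fun w hw => not_and_or.1 hw⟩

theorem finite_setOf_isIrreducibleComplete_not_isEtaleSet :
    {S : Set (𝒟.graph K).V | (𝒟.graph K).IsIrreducibleComplete S ∧
      ¬ 𝒟.IsEtaleSet K S}.Finite := by
  refine (DirectedGraph.finite_setOf_isIrreducibleComplete_inter
    ((𝒟.finite_setOf_not_isEtaleEdge K).image (𝒟.graph K).s)).subset ?_
  rintro S ⟨hS, hne⟩
  simp only [IsEtaleSet, not_forall] at hne
  obtain ⟨z, hz, -, hze⟩ := hne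
  exact ⟨hS, _, hz, z, hze, rfl⟩

end SelfCorrespondence

theorem mainTheorem11_general {k : Type u} [Field k] (K : Type u) [Field K] [Algebra k K]
    [IsAlgClosed K] {C : Scheme.{u}} (p : C ⟶ Spec (.of k)) [IrreducibleSpace C]
    [SmoothOfRelativeDimension 1 p] (𝒟 : SelfCorrespondence p) :
    {S : Set (𝒟.graph K).V | (𝒟.graph K).IsIrreducibleComplete S}.Infinite ∧
    {S : Set (𝒟.graph K).V | (𝒟.graph K).IsIrreducibleComplete S ∧
      ¬ 𝒟.IsEtaleSet K S}.Finite :=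
  ⟨𝒟.infinite_setOf_isIrreducibleComplete K,
    𝒟.finite_setOf_isIrreducibleComplete_not_isEtaleSet K⟩

theorem mainTheorem11 {k : Type u} [Field k] (kbar : Type u) [Field kbar] [Algebra k kbar]
    [IsAlgClosure k kbar] {C : Scheme.{u}} (p : C ⟶ Spec (.of k)) (hC : IsCurve p)
    (𝒟 : SelfCorrespondence p) :
    {S : Set (𝒟.graph kbar).V | (𝒟.graph kbar).IsIrreducibleComplete S}.Infinite ∧
    {S : Set (𝒟.graph kbar).V | (𝒟.graph kbar).IsIrreducibleComplete S ∧
      ¬ 𝒟.IsEtaleSet kbar S}.Finite :=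
  have := IsAlgClosure.isAlgClosed (K := kbar) k
  have := hC.irreducibleSpace
  have := hC.smooth
  mainTheorem11_general kbar p 𝒟
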